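/- Let $G$ be a finite-dimensional real Lie group with Lie algebra $\mathfrak g$, let $h\in\mathfrak g$ be an Euler element, i.e. $(\operatorname{ad} h)^3=\operatorname{ad} h\neq 0$, and suppose that the involution $e^{\pi i\operatorname{ad} h}$ of $\mathfrak g$ (which is $-1$ on the eigenspaces $\mathfrak g_{\pm1}(h)$ of $\operatorname{ad}h$ and $+1$ on $\mathfrak g_0(h)$) integrates to an involutive automorphism $\tau_h$ of $G$; put $G_{\tau_h}=G\rtimes_{\tau_h}\{\pm1\}$. Let $(U,\mathcal H)$ be an antiunitary representation of $G_{\tau_h}$ on a complex Hilbert space, i.e. a homomorphism into the group of unitary or antiunitary operators such that $U|_G$ is a strongly continuous unitary representation and $J:=U(\tau_h)$ is a conjugation. Let $\mathtt V=\mathtt V(h,U)=\operatorname{Fix}(J\Delta^{1/2})$ with $\Delta=e^{2\pi i\,\partial U(h)}$ be the corresponding standard subspace, where $\partial U(h)$ is the generator of $t\mapsto U(\exp th)$; explicitly, $\mathtt V$ consists of all $\xi\in\mathcal H$ whose orbit map $t\mapsto U(\exp th)\xi$ extends to a continuous map on $\{0\le \operatorname{Im} z\le\pi\}$ that is holomorphic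 in the interior and has the value $J\xi$ at $\pi i$. A real subspace $\mathtt E\subseteq\mathcal H$ is called cyclic if $\mathtt E+i\mathtt E$ is dense. For $N\subseteq G$ put $\mathtt V_N:=\bigcap_{g\in N}U(g)\mathtt V$; $U$ is called $h$-regular if $\mathtt V_N$ is cyclic for some $e$-neighborhood $N\subseteq G$. For a family $(\mathsf H(\mathcal O))_{\mathcal O\subseteq G}$ of closed real subspaces of $\mathcal H$, indexed by the open subsets of $G$, consider: (Iso) $\mathcal O_1\subseteq\mathcal O_2$ implies $\mathsf H(\mathcal O_1)\subseteq\mathsf H(\mathcal O_2)$; (Cov) $U(g)\mathsf H(\mathcal O)=\mathsf H(g\mathcal O)$ for $g\in G$; (RS) $\mathsf H(\mathcal O)$ is cyclic if $\mathcal O\neq\emptyset$; (BW) for an open subset $W\subseteq G$: $W$ is connected, $\exp(\mathbb Rh)W=W$, and $\mathsf H(W)=\mathtt V$. Then the following hold. (a) There exists a family $\mathsf H$ satisfying (Iso), (Cov), (RS) and (BW) for some open subset $W\subseteq G$ if and only if $U$ is $h$-regular. The same equivalence holds if (BW) is weakened to: $\mathsf H(W)=\mathtt V$ for some open subset $W\subseteq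 G$. (b) If $\mathsf H$ satisfies (Iso), (Cov), (RS), and $\mathsf H(W)=\mathtt V$ for an open subset $W\subseteq G$, then $\mathtt V_N$ is cyclic for every $e$-neighborhood $N$ for which there exists a non-empty open subset $\mathcal O\subseteq W$ with $N^{-1}\mathcal O\subseteq W$. (c) Conversely, let $N$ be an $e$-neighborhood for which $\mathtt V_N$ is cyclic and let $N_1$ be an open $e$-neighborhood with $N_1N_1^{-1}\subseteq N$. Then $W:=\exp(\mathbb Rh)N_1$ is open, $\exp(\mathbb Rh)W=W$, $W$ is connected if $N_1$ is connected, and $$\mathsf H(\mathcal O):=\bigcap_{g\in G,\ \mathcal O\subseteq gW}U(g)\mathtt V$$ (an empty intersection being $\mathcal H$) defines a family of closed real subspaces that satisfies (Iso), (Cov), (RS), and $\mathsf H(W)=\mathtt V$. -/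

import Mathlib

open Set Filter Topology
open TopologicalSpace (Opens)
open scoped Manifold ContDiff Pointwise

section LieExp

variable {E : Type*} [NormedAddCommGroup E] [NormedSpace ℝ E]
  {G : Type*} [TopologicalSpace G] [ChartedSpace E G] [Group G] [LieGroup 𝓘(ℝ, E) ∞ G]

/-- `γ : ℝ → G` is the one-parameter subgroup with velocity `x` at the identity. -/
structure IsOneParameterSubgroup (x : GroupLieAlgebra 𝓘(ℝ, E) G) (γ : ℝ → G) : Prop where
  map_add : ∀ s t : ℝ, γ (s + t) = γ s * γ t
  hasMFDerivAt_zero : HasMFDerivAt 𝓘(ℝ, ℝ) 𝓘(ℝ, E) γ 0 ((1 : ℝ →L[ℝ] ℝ).smulRight (x : E))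

theorem mulInvariantVectorField_mul_left (x : GroupLieAlgebra 𝓘(ℝ, E) G) (g k : G) :
    mfderiv 𝓘(ℝ, E) 𝓘(ℝ, E) (g * ·) k (mulInvariantVectorField x k)
      = mulInvariantVectorField x (g * k) := by
  have M : (∞ : WithTop ℕ∞) ≠ 0 := by simp
  have D : (fun y : G ↦ g * k * y) = (fun b ↦ g * b) ∘ (fun y ↦ k * y) := by
    ext y; simp [mul_assoc]
  have h1 : MDifferentiableAt 𝓘(ℝ, E) 𝓘(ℝ, E) (fun b : G ↦ g * b) (k * 1) :=
    (contMDiff_mul_left (n := ∞)).contMDiffAt.mdifferentiableAt M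
  have h2 : MDifferentiableAt 𝓘(ℝ, E) 𝓘(ℝ, E) (fun b : G ↦ k * b) 1 :=
    (contMDiff_mul_left (n := ∞)).contMDiffAt.mdifferentiableAt M
  simp only [mulInvariantVectorField]
  have h3 : ∀ k' : G, k' = k → (mfderiv 𝓘(ℝ, E) 𝓘(ℝ, E) (fun b : G ↦ g * b) k' : E →L[ℝ] E) =
      mfderiv 𝓘(ℝ, E) 𝓘(ℝ, E) (fun b : G ↦ g * b) k := by
    rintro _ rfl; rfl
  rw [D, mfderiv_comp (I' := 𝓘(ℝ, E)) _ h1 h2]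
  exact (congrArg (fun L : E →L[ℝ] E ↦ L (mfderiv 𝓘(ℝ, E) 𝓘(ℝ, E) (fun y : G ↦ k * y) 1 x))
    (h3 (k * 1) (mul_one k))).symm

theorem isMIntegralCurveOn_mul_left {x : GroupLieAlgebra 𝓘(ℝ, E) G} {γ : ℝ → G} {s : Set ℝ}
    (hγ : IsMIntegralCurveOn γ (mulInvariantVectorField x) s) (g : G) :
    IsMIntegralCurveOn (fun t ↦ g * γ t) (mulInvariantVectorField x) s := by
  intro t ht
  have M : (∞ : WithTop ℕ∞) ≠ 0 := by simp
  have h1 : MDifferentiableAt 𝓘(ℝ, E) 𝓘(ℝ, E) (fun b : G ↦ g * b) (γ t) :=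
    (contMDiff_mul_left (n := ∞)).contMDiffAt.mdifferentiableAt M
  have h2 := h1.hasMFDerivAt.comp_hasMFDerivWithinAt t (hγ t ht)
  rw [← mulInvariantVectorField_mul_left]
  have e : ∀ (L : E →L[ℝ] E) (w : E),
      L.comp ((1 : ℝ →L[ℝ] ℝ).smulRight w) = (1 : ℝ →L[ℝ] ℝ).smulRight (L w) := by
    intro L w; ext; simp
  have h3 := e (mfderiv 𝓘(ℝ, E) 𝓘(ℝ, E) (fun b : G ↦ g * b) (γ t))
    (mulInvariantVectorField x (γ t))
  exact h3 ▸ h2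

theorem exists_isOneParameterSubgroup [FiniteDimensional ℝ E] [T2Space G]
    (x : GroupLieAlgebra 𝓘(ℝ, E) G) : ∃ γ : ℝ → G, IsOneParameterSubgroup x γ := by
  have : CompleteSpace E := FiniteDimensional.complete ℝ E
  have : LieGroup 𝓘(ℝ, E) (minSmoothness ℝ 3) G := by
    rw [minSmoothness_of_isRCLikeNormedField]; infer_instance
  have : IsManifold 𝓘(ℝ, E) 1 G := IsManifold.of_le (n := ∞) (by simp)
  have hv : ContMDiff 𝓘(ℝ, E) 𝓘(ℝ, E).tangent 1
      (fun g : G ↦ (⟨g, mulInvariantVectorField x g⟩ : TangentBundle 𝓘(ℝ, E) G)) :=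
    (contMDiff_mulInvariantVectorField x).of_le
      (by rw [minSmoothness_of_isRCLikeNormedField]; norm_num)
  obtain ⟨γ₀, h0, hγ₀⟩ := exists_isMIntegralCurveAt_of_contMDiffAt_boundaryless 0
    (hv.contMDiffAt (x := (1 : G)))
  obtain ⟨ε, hε, hγ₁⟩ := isMIntegralCurveAt_iff'.mp hγ₀
  rw [Real.ball_eq_Ioo, zero_sub, zero_add] at hγ₁
  obtain ⟨γ, hγ0, hγ⟩ := exists_isMIntegralCurve_of_isMIntegralCurveOn hv hε
    (fun g ↦ ⟨fun t ↦ g * γ₀ t, by simp [h0], isMIntegralCurveOn_mul_left hγ₁ g⟩) (1 : G)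
  refine ⟨γ, fun s t ↦ ?_, ?_⟩
  · have hl : IsMIntegralCurve (fun t ↦ γ s * γ t) (mulInvariantVectorField x) := by
      rw [isMIntegralCurve_iff_isMIntegralCurveOn] at hγ ⊢
      exact isMIntegralCurveOn_mul_left hγ _
    have := isMIntegralCurve_Ioo_eq_of_contMDiff_boundaryless (t₀ := 0) hv (hγ.comp_add s) hl
      (by simp [hγ0])
    simpa [add_comm] using congrFun this t
  · have := hγ 0
    have e : mulInvariantVectorField x (γ 0) = (x : E) := by
      rw [hγ0]
      have h1 : (fun y : G ↦ 1 * y) = id := by ext y; simp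
      simp only [mulInvariantVectorField]
      rw [h1, mfderiv_id]
      rfl
    exact e ▸ this

/-- `expCurve x t = exp (t x)`, the one-parameter subgroup generated by `x`. -/
noncomputable def expCurve [FiniteDimensional ℝ E] [T2Space G] (x : GroupLieAlgebra 𝓘(ℝ, E) G) :
    ℝ → G :=
  Classical.choose (exists_isOneParameterSubgroup x)

theorem isOneParameterSubgroup_expCurve [FiniteDimensional ℝ E] [T2Space G]
    (x : GroupLieAlgebra 𝓘(ℝ, E) G) : IsOneParameterSubgroup x (expCurve x) :=
  Classical.choose_spec (exists_isOneParameterSubgroup x)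

/-- Euler elements: `(ad h)³ = ad h ≠ 0`. -/
structure IsEulerElement (h : GroupLieAlgebra 𝓘(ℝ, E) G) : Prop where
  ad_cube : ∀ x : GroupLieAlgebra 𝓘(ℝ, E) G, ⁅h, ⁅h, ⁅h, x⁆⁆⁆ = ⁅h, x⁆
  ad_ne_zero : ∃ x : GroupLieAlgebra 𝓘(ℝ, E) G, ⁅h, x⁆ ≠ 0

/-- `τ` is an involutive automorphism of the Lie group `G` whose differential at the identity is
`e^{π i ad h}`, that is, `x₁ + x₀ + x₋₁ ↦ -x₁ + x₀ - x₋₁` with respect to the eigenspaces of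
`ad h` for the eigenvalues `1, 0, -1`. -/
structure IsEulerInvolution (h : GroupLieAlgebra 𝓘(ℝ, E) G) (τ : G ≃* G) : Prop where
  contMDiff : ContMDiff 𝓘(ℝ, E) 𝓘(ℝ, E) ∞ τ
  involutive : ∀ g, τ (τ g) = g
  deriv_zero : ∀ x : GroupLieAlgebra 𝓘(ℝ, E) G, ⁅h, x⁆ = 0 →
    (mfderiv 𝓘(ℝ, E) 𝓘(ℝ, E) τ 1 x : E) = (x : E)
  deriv_one : ∀ x : GroupLieAlgebra 𝓘(ℝ, E) G, ⁅h, x⁆ = x →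
    (mfderiv 𝓘(ℝ, E) 𝓘(ℝ, E) τ 1 x : E) = -(x : E)
  deriv_neg_one : ∀ x : GroupLieAlgebra 𝓘(ℝ, E) G, ⁅h, x⁆ = -x →
    (mfderiv 𝓘(ℝ, E) 𝓘(ℝ, E) τ 1 x : E) = -(x : E)

end LieExp

section Antiunitary

/-- The action of `{±1}` on `G` through an involutive automorphism `τ`. -/
def signAction {G : Type*} [Group G] (τ : G ≃* G) (hτ : ∀ g, τ (τ g) = g) : ℤˣ →* MulAut G where
  toFun ε := if ε = 1 then 1 else τ
  map_one' := by simp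
  map_mul' a b := by
    rcases Int.units_eq_one_or a with rfl | rfl <;> rcases Int.units_eq_one_or b with rfl | rfl <;>
      ext g <;> simp [hτ]

/-- The group `G_τ = G ⋊_τ {±1}`. -/
abbrev ExtendedGroup {G : Type*} [Group G] (τ : G ≃* G) (hτ : ∀ g, τ (τ g) = g) : Type _ :=
  G ⋊[signAction τ hτ] ℤˣ

variable (H : Type*) [NormedAddCommGroup H] [InnerProductSpace ℂ H]

variable {H} in
/-- A surjective real-linear isometry is unitary if it is complex linear. -/
def IsUnitaryOp (T : H ≃ₗᵢ[ℝ] H) : Prop := ∀ (c : ℂ) (v : H), T (c • v) = c • T v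

variable {H} in
/-- A surjective real-linear isometry is antiunitary if it is antilinear. -/
def IsAntiunitaryOp (T : H ≃ₗᵢ[ℝ] H) : Prop :=
  ∀ (c : ℂ) (v : H), T (c • v) = (starRingEnd ℂ c) • T v

/-- `AU(H)`: the group of unitary or antiunitary operators on `H`. -/
def AU : Subgroup (H ≃ₗᵢ[ℝ] H) where
  carrier := {T | IsUnitaryOp T ∨ IsAntiunitaryOp T}
  one_mem' := Or.inl fun _ _ ↦ rfl
  mul_mem' := by
    rintro S T (hS | hS) (hT | hT)
    · exact Or.inl fun c v ↦ by simp [hT c v, hS c]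
    · exact Or.inr fun c v ↦ ((congrArg S (hT c v)).trans (hS _ _) :)
    · exact Or.inr fun c v ↦ by simp [hT c v, hS c]
    · refine Or.inl fun c v ↦ ((congrArg S (hT c v)).trans (hS _ _)).trans ?_
      rw [starRingEnd_self_apply]; rfl
  inv_mem' := by
    rintro T (hT | hT)
    · refine Or.inl fun c v ↦ T.injective ?_
      have h1 : ∀ w, T (T⁻¹ w) = w := T.apply_symm_apply
      rw [hT, h1, h1]
    · refine Or.inr fun c v ↦ T.injective ?_
      have h1 : ∀ w, T (T⁻¹ w) = w := T.apply_symm_apply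
      rw [hT, h1, h1, starRingEnd_self_apply]

/-- An antiunitary representation of `G_τ` on `H`: a homomorphism into `AU(H)` whose restriction
to `G` is a strongly continuous unitary representation and which maps `τ = (e, -1)` to a
conjugation (an antilinear isometry, involutive because `τ² = 1` in `G_τ`). -/
structure AntiunitaryRep {G : Type*} [Group G] [TopologicalSpace G] (τ : G ≃* G)
    (hτ : ∀ g, τ (τ g) = g) where
  toHom : ExtendedGroup τ hτ →* AU H
  unitary : ∀ g : G, IsUnitaryOp (toHom (SemidirectProduct.inl g) : H ≃ₗᵢ[ℝ] H)
  continuous : ∀ v : H, Continuous fun g : G ↦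
    (toHom (SemidirectProduct.inl g) : H ≃ₗᵢ[ℝ] H) v
  antiunitary : IsAntiunitaryOp (toHom (SemidirectProduct.inr (-1)) : H ≃ₗᵢ[ℝ] H)

variable {H}

/-- The operator `U(g)` for `g ∈ G`. -/
noncomputable def AntiunitaryRep.op {G : Type*} [Group G] [TopologicalSpace G] {τ : G ≃* G}
    {hτ : ∀ g, τ (τ g) = g} (U : AntiunitaryRep H τ hτ) (g : G) : H ≃ₗᵢ[ℝ] H :=
  (U.toHom (SemidirectProduct.inl g) : H ≃ₗᵢ[ℝ] H)

/-- The conjugation `J = U(τ)`. -/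
noncomputable def AntiunitaryRep.J {G : Type*} [Group G] [TopologicalSpace G] {τ : G ≃* G}
    {hτ : ∀ g, τ (τ g) = g} (U : AntiunitaryRep H τ hτ) : H ≃ₗᵢ[ℝ] H :=
  (U.toHom (SemidirectProduct.inr (-1)) : H ≃ₗᵢ[ℝ] H)

/-- The translate `U(g) V` of a real subspace. -/
noncomputable def AntiunitaryRep.translate {G : Type*} [Group G] [TopologicalSpace G] {τ : G ≃* G}
    {hτ : ∀ g, τ (τ g) = g} (U : AntiunitaryRep H τ hτ) (g : G) (V : Submodule ℝ H) :
    Submodule ℝ H :=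
  V.map ((U.op g).toLinearEquiv : H →ₗ[ℝ] H)

/-- A real subspace `V` is cyclic if `V + iV` is dense. -/
def IsCyclicSubspace (V : Submodule ℝ H) : Prop :=
  Dense {w : H | ∃ a ∈ V, ∃ b ∈ V, w = a + Complex.I • b}

/-- `F` is an extension of the orbit map `t ↦ u t ξ` to the strip `0 ≤ Im z ≤ π`, continuous on
the closed strip and holomorphic in its interior. -/
structure IsStripExtension (u : ℝ → H → H) (ξ : H) (F : ℂ → H) : Prop where
  continuousOn : ContinuousOn F {z : ℂ | 0 ≤ z.im ∧ z.im ≤ Real.pi}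
  differentiableOn : DifferentiableOn ℂ F {z : ℂ | 0 < z.im ∧ z.im < Real.pi}
  apply_real : ∀ t : ℝ, F t = u t ξ

end Antiunitary

section StandardSubspace

variable {E : Type*} [NormedAddCommGroup E] [NormedSpace ℝ E] [FiniteDimensional ℝ E]
  {G : Type*} [TopologicalSpace G] [ChartedSpace E G] [Group G] [LieGroup 𝓘(ℝ, E) ∞ G] [T2Space G]
  {H : Type*} [NormedAddCommGroup H] [InnerProductSpace ℂ H]
  {τ : G ≃* G} {hτ : ∀ g, τ (τ g) = g}

/-- The graph of the positive selfadjoint operator `Δ^{1/2} = e^{π i ∂U(h)}`, where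
`Δ = e^{2π i ∂U(h)}` and `∂U(h)` is the infinitesimal generator of the unitary one-parameter group
`U_h(t) = U(exp th) = e^{t ∂U(h)}`. It is the value at `z = π i` of the analytic continuation
`z ↦ e^{z ∂U(h)}` of this group: `ξ` is in the domain if and only if the orbit map of `ξ`
has an extension to the closed strip `0 ≤ Im z ≤ π`, and then `Δ^{1/2} ξ` is the value at `π i`. -/
noncomputable def AntiunitaryRep.sqrtModularGraph (U : AntiunitaryRep H τ hτ)
    (h : GroupLieAlgebra 𝓘(ℝ, E) G) : Submodule ℂ (H × H) where
  carrier := {p | ∃ F : ℂ → H,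
    IsStripExtension (fun t ↦ U.op (expCurve h t)) p.1 F ∧ F (Real.pi * Complex.I) = p.2}
  zero_mem' := ⟨0, ⟨continuousOn_const, differentiableOn_const 0, by simp⟩, rfl⟩
  add_mem' := by
    rintro p q ⟨F, hF, hp⟩ ⟨F', hF', hq⟩
    exact ⟨F + F', ⟨hF.1.add hF'.1, hF.2.add hF'.2,
      fun t ↦ by simp [hF.3 t, hF'.3 t]⟩, by simp [hp, hq]⟩
  smul_mem' := by
    rintro c p ⟨F, hF, hp⟩
    exact ⟨c • F, ⟨hF.1.const_smul c, hF.2.const_smul c,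
      fun t ↦ by simp [hF.3 t, AntiunitaryRep.op, U.unitary _ c]⟩, by simp [hp]⟩

/-- The standard subspace `V(h, U) = Fix(J Δ^{1/2})`: since `J² = 1`, it consists of all `ξ` in the
domain of `Δ^{1/2}` with `Δ^{1/2} ξ = J ξ`. -/
noncomputable def AntiunitaryRep.standardSubspace (U : AntiunitaryRep H τ hτ)
    (h : GroupLieAlgebra 𝓘(ℝ, E) G) : Submodule ℝ H where
  carrier := {ξ | (ξ, U.J ξ) ∈ U.sqrtModularGraph h}
  zero_mem' := by
    have h0 : ((0 : H), U.J 0) = 0 := by simp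
    exact (congrArg (· ∈ U.sqrtModularGraph h) h0).mpr (U.sqrtModularGraph h).zero_mem
  add_mem' := by
    intro a b ha hb
    have := (U.sqrtModularGraph h).add_mem ha hb
    simpa using this
  smul_mem' := by
    intro c a ha
    have := (U.sqrtModularGraph h).smul_mem (c : ℂ) ha
    simpa using this

/-- `V_N = ⋂_{g ∈ N} U(g) V` for `V = V(h, U)`. -/
noncomputable def AntiunitaryRep.coreSubspace (U : AntiunitaryRep H τ hτ) (h : GroupLieAlgebra 𝓘(ℝ, E) G)
    (N : Set G) : Submodule ℝ H :=
  ⨅ g ∈ N, U.translate g (U.standardSubspace h)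

/-- `U` is `h`-regular if `V_N` is cyclic for some identity neighbourhood `N`. -/
def AntiunitaryRep.IsRegular (U : AntiunitaryRep H τ hτ) (h : GroupLieAlgebra 𝓘(ℝ, E) G) : Prop :=
  ∃ N ∈ 𝓝 (1 : G), IsCyclicSubspace (U.coreSubspace h N)

end StandardSubspace

section Nets

variable {G : Type*} [Group G] [TopologicalSpace G] [IsTopologicalGroup G]
  {H : Type*} [NormedAddCommGroup H] [InnerProductSpace ℂ H]
  {τ : G ≃* G} {hτ : ∀ g, τ (τ g) = g}

/-- The translate `gO` of an open subset `O ⊆ G`. -/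
def translateOpens (g : G) (O : Opens G) : Opens G := ⟨g • (O : Set G), O.isOpen.smul g⟩

/-- A net of closed real subspaces, indexed by the open subsets of `G`, with the properties
(Iso), (Cov) and (RS) with respect to `U`. -/
structure IsCovariantNet (U : AntiunitaryRep H τ hτ) (K : Opens G → Submodule ℝ H) : Prop where
  isClosed : ∀ O, IsClosed (K O : Set H)
  isotony : ∀ O₁ O₂, O₁ ≤ O₂ → K O₁ ≤ K O₂
  covariance : ∀ g O, U.translate g (K O) = K (translateOpens g O)
  reehSchlieder : ∀ O : Opens G, (O : Set G).Nonempty → IsCyclicSubspace (K O)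

/-- The real subspaces `⋂_{O ⊆ gW} U(g) V`, for open subsets `O ⊆ G`. -/
noncomputable def maximalNet (U : AntiunitaryRep H τ hτ) (V : Submodule ℝ H) (W : Opens G) (O : Opens G) :
    Submodule ℝ H :=
  ⨅ (g : G) (_ : O ≤ translateOpens g W), U.translate g V

/-- (BW): `W` is a connected open subset, invariant under `exp(ℝh)`, and `K W = V(h, U)`. -/
structure BisognanoWichmann {E : Type*} [NormedAddCommGroup E] [NormedSpace ℝ E] [FiniteDimensional ℝ E]
    [ChartedSpace E G] [LieGroup 𝓘(ℝ, E) ∞ G] [T2Space G] (U : AntiunitaryRep H τ hτ)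
    (h : GroupLieAlgebra 𝓘(ℝ, E) G) (K : Opens G → Submodule ℝ H) (W : Opens G) : Prop where
  isConnected : IsConnected (W : Set G)
  invariant : ∀ t : ℝ, translateOpens (expCurve h t) W = W
  eq_standardSubspace : K W = U.standardSubspace h

end Nets

/-! ### Uniqueness of analytic continuation to the strip `0 ≤ Im z ≤ π` -/

section Strip

open Complex

/-! Write `V = V(h, U)`. Given a net `K` with `K W = V`, the inclusion `g⁻¹O ⊆ W` means `O ⊆ gW`, so
isotony and covariance give `K O ⊆ U(g)V`. If this holds for all `g ∈ N`, the cyclic space `K O`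
lies in `V_N`. Continuity of `(g, k) ↦ g⁻¹k` supplies such `N` and `O` when `W ≠ ∅`; when `W = ∅`,
covariance makes `V` invariant under `G`, and cyclicity of `V` itself suffices.

Conversely, let `W = exp(ℝh)N₁`. If `k ∈ O ⊆ gW`, then `k = g exp(th) n` with `n ∈ N₁`, and since
`exp(ℝh)` preserves `V`, one gets `U(g)V = U(kn⁻¹)V ⊇ U(k)V_N`. So the maximal net at `O` contains
`U(k)V_N` (`translate_coreSubspace_le_maximalNet`), which gives (RS). At `W` it is a closed, cyclic,
modular-invariant subspace of `V`, hence equal to `V` by `eq_of_isCyclicSubspace`.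

The facts needed about `V` (closed, cyclic, no proper subspace of this kind) come from strip
extensions and Gaussian averages of orbits, without spectral theory: the averages have entire orbit
maps, so `Δ^{1/2}` acts on them by evaluation at `πi`. -/

theorem convex_openStrip : Convex ℝ {z : ℂ | 0 < z.im ∧ z.im < Real.pi} :=
  (convex_halfSpace_im_gt 0).inter (convex_halfSpace_im_lt Real.pi)

theorem isOpen_openStrip : IsOpen {z : ℂ | 0 < z.im ∧ z.im < Real.pi} :=
  (isOpen_lt continuous_const continuous_im).inter (isOpen_lt continuous_im continuous_const)

theorem closure_openStrip :
    closure {z : ℂ | 0 < z.im ∧ z.im < Real.pi} = {z : ℂ | 0 ≤ z.im ∧ z.im ≤ Real.pi} := by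
  have h := closure_reProdIm univ (Ioo 0 Real.pi)
  rw [closure_univ, closure_Ioo Real.pi_pos.ne] at h
  have e1 : (univ : Set ℝ) ×ℂ Ioo 0 Real.pi = {z : ℂ | 0 < z.im ∧ z.im < Real.pi} := by
    ext z; simp [mem_reProdIm]
  have e2 : (univ : Set ℝ) ×ℂ Icc 0 Real.pi = {z : ℂ | 0 ≤ z.im ∧ z.im ≤ Real.pi} := by
    ext z; simp [mem_reProdIm]
  rwa [e1, e2] at h

/-- A continuous function on the closed strip which is holomorphic in the interior and vanishes on
the real line vanishes on the lower half of the strip: multiply the four rotates of `f` about the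
centre of a square which has one side on the real line. -/
theorem eq_zero_of_real_zero_of_im_le {f : ℂ → ℂ}
    (hc : ContinuousOn f {z : ℂ | 0 ≤ z.im ∧ z.im ≤ Real.pi})
    (hd : DifferentiableOn ℂ f {z : ℂ | 0 < z.im ∧ z.im < Real.pi})
    (h0 : ∀ z : ℂ, z.im = 0 → f z = 0) {w : ℂ} (hw : 0 < w.im) (hw' : w.im ≤ Real.pi / 2) :
    f w = 0 := by
  set y := w.im with hy
  -- Moved to centre `w`, this square has its lower side on the real line, and it stays in the strip
  -- because `2y ≤ π`.
  set Q : Set ℂ := Ioo (-y) y ×ℂ Ioo (-y) y with hQ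
  have hne : -y ≠ y := by linarith
  have hcl : closure Q = Icc (-y) y ×ℂ Icc (-y) y := by
    rw [hQ, closure_reProdIm, closure_Ioo hne]
  have key : ∀ c : ℂ, c = 1 ∨ c = I ∨ c = -1 ∨ c = -I →
      DiffContOnCl ℂ (fun z ↦ f (w + c * z)) Q := by
    intro c hcc
    refine ⟨?_, ?_⟩
    · refine hd.comp (by fun_prop) fun z hz ↦ ?_
      obtain ⟨⟨h1, h2⟩, h3, h4⟩ := mem_reProdIm.1 hz
      rcases hcc with rfl | rfl | rfl | rfl <;> constructor <;> simp <;> linarith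
    · refine hc.comp (by fun_prop) fun z hz ↦ ?_
      rw [hcl] at hz
      obtain ⟨⟨h1, h2⟩, h3, h4⟩ := mem_reProdIm.1 hz
      rcases hcc with rfl | rfl | rfl | rfl <;> constructor <;> simp <;> linarith
  have hg : DiffContOnCl ℂ (fun z ↦ f (w + 1 * z) * f (w + I * z) *
      (f (w + -1 * z) * f (w + -I * z))) Q := by
    have := ((key 1 (by simp)).smul (key I (by simp))).smul
      ((key (-1) (by simp)).smul (key (-I) (by simp)))
    simpa only [smul_eq_mul] using this
  have hbd : Bornology.IsBounded Q := (Metric.isBounded_Ioo _ _).reProdIm (Metric.isBounded_Ioo _ _)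
  have hfr : ∀ z ∈ frontier Q, ‖f (w + 1 * z) * f (w + I * z) *
      (f (w + -1 * z) * f (w + -I * z))‖ ≤ 0 := by
    intro z hz
    rw [hQ, frontier_reProdIm, frontier_Ioo (by linarith)] at hz
    have hz' : z.im = -y ∨ z.im = y ∨ z.re = -y ∨ z.re = y := by
      rcases hz with hz | hz
      · have := (mem_reProdIm.1 hz).2
        simp only [mem_insert_iff, mem_singleton_iff] at this; tauto
      · have := (mem_reProdIm.1 hz).1
        simp only [mem_insert_iff, mem_singleton_iff] at this; tauto
    refine le_of_eq (norm_eq_zero.2 ?_)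
    rcases hz' with h | h | h | h
    · rw [h0 (w + 1 * z) (by simp [h, hy])]; simp
    · rw [h0 (w + -1 * z) (by simp [h, hy])]; simp
    · rw [h0 (w + I * z) (by simp [h, hy])]; simp
    · rw [h0 (w + -I * z) (by simp [h, hy])]; simp
  have hz0 : (0 : ℂ) ∈ closure Q := by
    rw [hcl]; exact mem_reProdIm.2 ⟨⟨by simp; linarith, by simp; linarith⟩,
      ⟨by simp; linarith, by simp; linarith⟩⟩
  -- At the centre `z = 0` the product is `f w ^ 4`.
  have := norm_le_zero_iff.1 (norm_le_of_forall_mem_frontier_norm_le hbd hg hfr hz0)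
  simpa using this

/-- The identity theorem carries the vanishing from the lower half to the whole open strip, and
continuity to its closure. -/
theorem eq_zero_of_real_zero {f : ℂ → ℂ}
    (hc : ContinuousOn f {z : ℂ | 0 ≤ z.im ∧ z.im ≤ Real.pi})
    (hd : DifferentiableOn ℂ f {z : ℂ | 0 < z.im ∧ z.im < Real.pi})
    (h0 : ∀ t : ℝ, f t = 0) {w : ℂ} (hw : 0 ≤ w.im) (hw' : w.im ≤ Real.pi) :
    f w = 0 := by
  have h0' : ∀ z : ℂ, z.im = 0 → f z = 0 := by
    intro z hz
    rw [← h0 z.re]; congr 1; exact Complex.ext (by simp) (by simp [hz])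
  have hpi := Real.pi_pos
  have hev : f =ᶠ[𝓝 ((Real.pi / 4 : ℝ) * I)] 0 := by
    have : {z : ℂ | 0 < z.im ∧ z.im < Real.pi / 2} ∈ 𝓝 (((Real.pi / 4 : ℝ) : ℂ) * I) := by
      refine ((isOpen_lt continuous_const continuous_im).inter
        (isOpen_lt continuous_im continuous_const)).mem_nhds ⟨?_, ?_⟩ <;>
      simp only [mem_ofPred_eq, im_ofReal_mul, I_im] <;> linarith
    filter_upwards [this] with z hz
    exact eq_zero_of_real_zero_of_im_le hc hd h0' hz.1 hz.2.le
  have hopen : EqOn f 0 {z : ℂ | 0 < z.im ∧ z.im < Real.pi} :=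
    (hd.analyticOnNhd isOpen_openStrip).eqOn_of_preconnected_of_eventuallyEq
      (fun _ _ ↦ analyticAt_const) convex_openStrip.isPreconnected
      (by constructor <;> simp only [im_ofReal_mul, I_im] <;> linarith) hev
  exact hopen.of_subset_closure hc continuousOn_const (fun z hz ↦ ⟨hz.1.le, hz.2.le⟩)
    closure_openStrip.ge ⟨hw, hw'⟩

variable {H : Type*} [NormedAddCommGroup H] [InnerProductSpace ℂ H] {u : ℝ → H → H}
  {ξ η : H} {F F' : ℂ → H}

/-- Pairing the difference with its own value at the given point reduces this to scalar functions.
-/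
theorem IsStripExtension.eqOn (hF : IsStripExtension u ξ F) (hF' : IsStripExtension u ξ F') :
    EqOn F F' {z : ℂ | 0 ≤ z.im ∧ z.im ≤ Real.pi} := by
  intro z hz
  have h := eq_zero_of_real_zero (f := fun w ↦ innerSL ℂ (F z - F' z) (F w - F' w))
    ((innerSL ℂ _).continuous.comp_continuousOn (hF.1.sub hF'.1))
    ((innerSL ℂ _).differentiable.comp_differentiableOn (hF.2.sub hF'.2))
    (fun t ↦ by simp [hF.3, hF'.3]) hz.1 hz.2
  rw [innerSL_apply_apply, inner_self_eq_zero, sub_eq_zero] at h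
  exact h

end Strip
-- Modular pairs: strip extensions and closedness of `Fix(J Δ^{1/2})`
/-- A strongly continuous unitary one-parameter group `u` together with a commuting conjugation
`J`. -/
structure IsModularPair {H : Type*} [NormedAddCommGroup H] [InnerProductSpace ℂ H]
    (u : ℝ → H ≃ₗᵢ[ℝ] H) (J : H ≃ₗᵢ[ℝ] H) : Prop where
  add_apply : ∀ s t v, u (s + t) v = u s (u t v)
  unitary : ∀ t, IsUnitaryOp (u t)
  continuous : ∀ v, Continuous fun t ↦ u t v
  antiunitary : IsAntiunitaryOp J
  involutive : ∀ v, J (J v) = v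
  commute : ∀ t v, J (u t v) = u t (J v)

section ModularPair

open Complex

variable {H : Type*} [NormedAddCommGroup H] [InnerProductSpace ℂ H]

theorem IsUnitaryOp.exists_continuousLinearMap {T : H ≃ₗᵢ[ℝ] H} (hT : IsUnitaryOp T) :
    ∃ L : H →L[ℂ] H, ∀ v, L v = T v :=
  ⟨⟨⟨⟨T, map_add T⟩, hT⟩, T.continuous⟩, fun _ ↦ rfl⟩

/-- Membership in `Fix(J Δ^{1/2})`, for the modular operator with `Δ^{-it/2π} = u t`. -/
def IsModularFixed (u : ℝ → H ≃ₗᵢ[ℝ] H) (J : H ≃ₗᵢ[ℝ] H) (ξ : H) : Prop :=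
  ∃ F : ℂ → H, IsStripExtension (fun t ↦ u t) ξ F ∧ F (Real.pi * I) = J ξ

variable {u : ℝ → H ≃ₗᵢ[ℝ] H} {J : H ≃ₗᵢ[ℝ] H} {ξ η : H} {F F' : ℂ → H}

namespace IsModularPair

theorem zero_apply (hu : IsModularPair u J) (v : H) : u 0 v = v := by
  have := hu.add_apply 0 0 v
  rw [add_zero] at this
  exact ((u 0).injective this).symm

theorem stripExtension_apply (hu : IsModularPair u J)
    (hF : IsStripExtension (fun t ↦ u t) ξ F) (s : ℝ) :
    IsStripExtension (fun t ↦ u t) (u s ξ) (fun z ↦ u s (F z)) := by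
  obtain ⟨L, hL⟩ := (hu.unitary s).exists_continuousLinearMap
  simp only [← hL]
  refine ⟨L.continuous.comp_continuousOn hF.1, L.differentiable.comp_differentiableOn hF.2,
    fun t ↦ ?_⟩
  rw [hF.3, hL, hL, ← hu.add_apply, ← hu.add_apply, add_comm]

theorem stripExtension_translate (hu : IsModularPair u J)
    (hF : IsStripExtension (fun t ↦ u t) ξ F) (s : ℝ) :
    IsStripExtension (fun t ↦ u t) (u s ξ) (fun z ↦ F (z + s)) := by
  refine ⟨hF.1.comp (by fun_prop) fun z hz ↦ by simpa using hz,
    hF.2.comp (by fun_prop) fun z hz ↦ by simpa using hz, fun t ↦ ?_⟩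
  rw [← ofReal_add, hF.3, hu.add_apply]

/-- Both sides extend the orbit map of `u s ξ`. -/
theorem stripExtension_add_real (hu : IsModularPair u J)
    (hF : IsStripExtension (fun t ↦ u t) ξ F) {z : ℂ} (hz : 0 ≤ z.im ∧ z.im ≤ Real.pi) (s : ℝ) :
    F (z + s) = u s (F z) :=
  (hu.stripExtension_translate hF s).eqOn (hu.stripExtension_apply hF s) hz

/-- By equivariance `‖F z‖` depends only on `Im z`, so compactness of `[0, π]` bounds it on the
strip. The growth condition of Phragmén–Lindelöf then holds trivially, and the two edges give the
bound. -/
theorem norm_stripExtension_le (hu : IsModularPair u J)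
    (hF : IsStripExtension (fun t ↦ u t) ξ F) {z : ℂ} (hz : 0 ≤ z.im ∧ z.im ≤ Real.pi) :
    ‖F z‖ ≤ max ‖ξ‖ ‖F (Real.pi * I)‖ := by
  have hpi := Real.pi_pos
  have hnorm : ∀ w : ℂ, 0 ≤ w.im ∧ w.im ≤ Real.pi → ‖F w‖ = ‖F (w.im * I)‖ := by
    intro w hw
    have h := hu.stripExtension_add_real hF (z := w.im * I) (by simpa using hw) w.re
    rw [add_comm, re_add_im] at h
    rw [h, (u w.re).norm_map]
  obtain ⟨C, hC⟩ : ∃ C, ∀ y ∈ Icc 0 Real.pi, ‖F ((y : ℂ) * I)‖ ≤ C :=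
    isCompact_Icc.exists_bound_of_continuousOn
      (hF.1.comp (Continuous.continuousOn (by fun_prop)) fun y hy ↦ by simpa using hy)
  refine PhragmenLindelof.horizontal_strip (a := 0) (b := Real.pi) ⟨?_, ?_⟩
    ⟨0, by simp, 0, ?_⟩ ?_ ?_ hz.1 hz.2
  · exact hF.2
  · exact closure_openStrip ▸ hF.1
  · refine Asymptotics.IsBigO.of_bound C ?_
    refine mem_inf_of_right ?_
    rw [mem_principal]
    intro w hw
    have hw' : 0 ≤ w.im ∧ w.im ≤ Real.pi := ⟨hw.1.le, hw.2.le⟩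
    simpa [hnorm w hw'] using hC _ hw'
  · intro w hw
    rw [hnorm w (by simp [hw, hpi.le]), hw]
    have := hF.3 0
    simp only [ofReal_zero, hu.zero_apply] at this
    simp [this]
  · intro w hw
    rw [hnorm w (by simp [hw, hpi.le]), hw]
    exact le_max_right _ _

theorem _root_.IsStripExtension.sub (hF : IsStripExtension (fun t ↦ u t) ξ F)
    (hF' : IsStripExtension (fun t ↦ u t) η F') :
    IsStripExtension (fun t ↦ u t) (ξ - η) (F - F') :=
  ⟨hF.1.sub hF'.1, hF.2.sub hF'.2, fun t ↦ by simp [hF.3, hF'.3]⟩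

/-- Since the value at `πi` is `J ξ`, both edge bounds for a difference of extensions equal the
distance of the vectors. Extensions of a convergent sequence are thus uniformly Cauchy, and their
limit is the extension sought. -/
theorem isClosed_modularFixed [CompleteSpace H] (hu : IsModularPair u J) :
    IsClosed {ξ | IsModularFixed u J ξ} := by
  refine IsSeqClosed.isClosed fun x ξ hx hlim ↦ ?_
  choose F hF hFpi using hx
  have hbd : ∀ m n, ∀ z ∈ {z : ℂ | 0 ≤ z.im ∧ z.im ≤ Real.pi},
      dist (F m z) (F n z) ≤ dist (x m) (x n) := by
    intro m n z hz
    have h := hu.norm_stripExtension_le ((hF m).sub (hF n)) hz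
    rw [Pi.sub_apply, Pi.sub_apply, hFpi, hFpi, ← map_sub, J.norm_map, max_self] at h
    rwa [dist_eq_norm, dist_eq_norm]
  have hcau : UniformCauchySeqOn F atTop {z : ℂ | 0 ≤ z.im ∧ z.im ≤ Real.pi} := by
    rw [Metric.uniformCauchySeqOn_iff]
    intro ε hε
    obtain ⟨N, hN⟩ := Metric.cauchySeq_iff.1 hlim.cauchySeq ε hε
    exact ⟨N, fun m hm n hn z hz ↦ (hbd m n z hz).trans_lt (hN m hm n hn)⟩
  -- The membership condition sits under the existential so that the limit is a function on all of
  -- `ℂ`; its values off the strip are irrelevant.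
  have hex : ∀ z : ℂ, ∃ l, z ∈ {z : ℂ | 0 ≤ z.im ∧ z.im ≤ Real.pi} →
      Tendsto (fun n ↦ F n z) atTop (𝓝 l) := by
    intro z
    by_cases hz : z ∈ {z : ℂ | 0 ≤ z.im ∧ z.im ≤ Real.pi}
    · obtain ⟨l, hl⟩ := cauchySeq_tendsto_of_complete (hcau.cauchySeq hz)
      exact ⟨l, fun _ ↦ hl⟩
    · exact ⟨0, fun h ↦ (hz h).elim⟩
  choose G hG using hex
  have hunif : TendstoUniformlyOn F G atTop {z : ℂ | 0 ≤ z.im ∧ z.im ≤ Real.pi} :=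
    hcau.tendstoUniformlyOn_of_tendsto hG
  refine ⟨G, ⟨hunif.continuousOn (.of_forall fun n ↦ (hF n).1), ?_, fun t ↦ ?_⟩, ?_⟩
  · exact (hunif.mono fun z hz ↦ ⟨hz.1.le, hz.2.le⟩).tendstoLocallyUniformlyOn.differentiableOn
      (.of_forall fun n ↦ (hF n).2) isOpen_openStrip
  · refine tendsto_nhds_unique (hG t (by simp [Real.pi_pos.le])) ?_
    simp only [(hF _).3]
    exact ((u t).continuous.tendsto ξ).comp hlim
  · refine tendsto_nhds_unique (hG (Real.pi * I) (by simp [Real.pi_pos.le])) ?_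
    simp only [hFpi]
    exact (J.continuous.tendsto ξ).comp hlim

theorem isModularFixed_apply (hu : IsModularPair u J) (hξ : IsModularFixed u J ξ) (s : ℝ) :
    IsModularFixed u J (u s ξ) := by
  obtain ⟨F, hF, hpi⟩ := hξ
  exact ⟨_, hu.stripExtension_apply hF s, by rw [hpi, hu.commute]⟩

end IsModularPair

end ModularPair
-- Gaussian averages of orbits
section Gaussian

open Complex MeasureTheory

variable {H : Type*} [NormedAddCommGroup H] [InnerProductSpace ℂ H]

/-- The Gaussian regularization `∫ e^{-b(t-z)²} u t ξ dt` of the orbit map of `ξ`. -/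
noncomputable def gaussianSmoothing (u : ℝ → H ≃ₗᵢ[ℝ] H) (b : ℝ) (z : ℂ) (ξ : H) : H :=
  ∫ t : ℝ, cexp (-b * (t - z) ^ 2) • u t ξ

theorem integrable_gaussianKernel {b : ℝ} (hb : 0 < b) (z : ℂ) :
    Integrable fun t : ℝ ↦ cexp (-b * (t - z) ^ 2) := by
  refine (integrable_cexp_quadratic (b := b) (by simpa using hb) (2 * b * z) (-b * z ^ 2)).congr
    (.of_forall fun t ↦ ?_)
  simp only
  congr 1; ring

theorem norm_gaussianKernel (b t : ℝ) (z : ℂ) :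
    ‖cexp (-b * (t - z) ^ 2)‖ = Real.exp (-b * ((t - z.re) ^ 2 - z.im ^ 2)) := by
  rw [norm_exp]
  congr 1
  simp [pow_two]

variable {u : ℝ → H ≃ₗᵢ[ℝ] H} {J : H ≃ₗᵢ[ℝ] H} {b : ℝ}

namespace IsModularPair

theorem integrable_gaussian_orbit (hu : IsModularPair u J) (hb : 0 < b) (z : ℂ) (ξ : H) :
    Integrable fun t : ℝ ↦ cexp (-b * (t - z) ^ 2) • u t ξ := by
  refine ((integrable_gaussianKernel hb z).norm.mul_const ‖ξ‖).mono' ?_ (.of_forall fun t ↦ ?_)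
  · exact (Continuous.smul (by fun_prop) (hu.continuous ξ)).aestronglyMeasurable
  · rw [norm_smul, (u t).norm_map]

theorem exists_gaussianSmoothing_clm (hu : IsModularPair u J) (hb : 0 < b) (z : ℂ) :
    ∃ L : H →L[ℂ] H, ∀ ξ, L ξ = gaussianSmoothing u b z ξ := by
  refine ⟨LinearMap.mkContinuous
    { toFun := gaussianSmoothing u b z, map_add' := fun v w ↦ ?_, map_smul' := fun c v ↦ ?_ }
    (∫ t : ℝ, ‖cexp (-b * (t - z) ^ 2)‖) fun v ↦ ?_, fun ξ ↦ rfl⟩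
  · simp only [gaussianSmoothing, map_add, smul_add]
    exact integral_add (hu.integrable_gaussian_orbit hb z v) (hu.integrable_gaussian_orbit hb z w)
  · simp only [gaussianSmoothing, hu.unitary _ c, RingHom.id_apply]
    rw [← integral_smul]
    simp only [smul_comm c]
  · refine (norm_integral_le_integral_norm _).trans_eq ?_
    rw [← integral_mul_const]
    simp only [norm_smul, LinearIsometryEquiv.norm_map]

theorem apply_gaussianSmoothing (hu : IsModularPair u J) (s : ℝ) (z : ℂ) (ξ : H) :
    u s (gaussianSmoothing u b z ξ) = gaussianSmoothing u b (z + s) ξ := by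
  have h : u s (gaussianSmoothing u b z ξ) = ∫ t : ℝ, u s (cexp (-b * (t - z) ^ 2) • u t ξ) :=
    ((u s).toContinuousLinearEquiv.integral_comp_comm _).symm
  rw [h, gaussianSmoothing, 
    ← integral_add_right_eq_self (fun t : ℝ ↦ cexp (-b * (t - (z + s)) ^ 2) • u t ξ) s]
  refine integral_congr_ae (.of_forall fun t ↦ ?_)
  simp only [hu.unitary s _, ← hu.add_apply]
  rw [add_comm s t]
  congr 3
  push_cast; ring

theorem conj_gaussianSmoothing (hu : IsModularPair u J) (z : ℂ) (ξ : H) :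
    J (gaussianSmoothing u b z ξ) = gaussianSmoothing u b (starRingEnd ℂ z) (J ξ) := by
  have h : J (gaussianSmoothing u b z ξ) = ∫ t : ℝ, J (cexp (-b * (t - z) ^ 2) • u t ξ) :=
    (J.toContinuousLinearEquiv.integral_comp_comm _).symm
  rw [h, gaussianSmoothing]
  refine integral_congr_ae (.of_forall fun t ↦ ?_)
  simp only [hu.antiunitary _, hu.commute, ← exp_conj]
  simp

/-- Differentiation under the integral: on the unit ball about `z₀` the derivative of the kernel is
dominated by a linear factor times a Gaussian of half the rate, centred at `Re z₀`. -/
theorem differentiable_gaussianSmoothing (hu : IsModularPair u J) (hb : 0 < b) (ξ : H) :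
    Differentiable ℂ fun z ↦ gaussianSmoothing u b z ξ := by
  intro z₀
  set D : ℝ := |z₀.im| + 1 with hD
  have hDpos : 0 < D := by positivity
  have hint : Integrable fun t : ℝ ↦ (|t - z₀.re| + D) * Real.exp (-(b / 2) * (t - z₀.re) ^ 2) := by
    have h1 := ((integrable_mul_exp_neg_mul_sq (half_pos hb)).norm.add
      ((integrable_exp_neg_mul_sq (half_pos hb)).const_mul D)).comp_sub_right z₀.re
    refine h1.congr (.of_forall fun t ↦ ?_)
    simp only [Pi.add_apply, norm_mul, Real.norm_eq_abs, Real.abs_exp]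
    ring
  have hmeas : ∀ z : ℂ, AEStronglyMeasurable (fun t : ℝ ↦ cexp (-b * (t - z) ^ 2) • u t ξ) volume :=
    fun z ↦ (Continuous.smul (by fun_prop) (hu.continuous ξ)).aestronglyMeasurable
  refine (hasDerivAt_integral_of_dominated_loc_of_deriv_le (s := Metric.ball z₀ 1)
    (F := fun z t ↦ cexp (-b * ((t : ℝ) - z) ^ 2) • u t ξ)
    (F' := fun z t ↦ (cexp (-b * ((t : ℝ) - z) ^ 2) * (2 * b * (t - z))) • u t ξ)
    (bound := fun t ↦ (2 * b * Real.exp (b * (1 + D ^ 2)) * ‖ξ‖) *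
      ((|t - z₀.re| + D) * Real.exp (-(b / 2) * (t - z₀.re) ^ 2)))
    (Metric.ball_mem_nhds z₀ one_pos) (.of_forall hmeas)
    (hu.integrable_gaussian_orbit hb z₀ ξ)
    (Continuous.smul (by fun_prop) (hu.continuous ξ)).aestronglyMeasurable
    (.of_forall fun t z hz ↦ ?_) (hint.const_mul _)
    (.of_forall fun t z _ ↦ ?_)).2.differentiableAt
  · have hz' : ‖z - z₀‖ ≤ 1 := by rw [← dist_eq_norm]; exact hz.le
    have hre : |z.re - z₀.re| ≤ 1 := by
      simpa using (abs_re_le_norm (z - z₀)).trans hz'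
    have him : |z.im - z₀.im| ≤ 1 := by
      simpa using (abs_im_le_norm (z - z₀)).trans hz'
    have h1 : ‖(t : ℂ) - z‖ ≤ |t - z₀.re| + D := by
      have e1 : (t : ℂ) - z = (t - z₀) - (z - z₀) := by ring
      have e2 : ‖(t : ℂ) - z₀‖ ≤ |t - z₀.re| + |z₀.im| := by
        simpa using norm_le_abs_re_add_abs_im ((t : ℂ) - z₀)
      rw [e1]
      refine (norm_sub_le _ _).trans ?_
      linarith
    have himD : z.im ^ 2 ≤ D ^ 2 := by
      refine sq_le_sq' ?_ ?_
      · have := neg_abs_le z₀.im; have := (abs_le.1 him).1; linarith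
      · have := le_abs_self z₀.im; have := (abs_le.1 him).2; linarith
    have hresq : (z.re - z₀.re) ^ 2 ≤ 1 := by
      rw [sq_le_one_iff_abs_le_one]; exact hre
    have h2 : Real.exp (-b * ((t - z.re) ^ 2 - z.im ^ 2)) ≤
        Real.exp (b * (1 + D ^ 2)) * Real.exp (-(b / 2) * (t - z₀.re) ^ 2) := by
      rw [← Real.exp_add, Real.exp_le_exp]
      have h3 : (t - z₀.re) ^ 2 / 2 ≤ (t - z.re) ^ 2 + 1 := by
        nlinarith [sq_nonneg ((t - z.re) - (z.re - z₀.re))]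
      nlinarith
    rw [norm_smul, (u t).norm_map, norm_mul, norm_gaussianKernel]
    have h4 : ‖2 * (b : ℂ) * (t - z)‖ ≤ 2 * b * (|t - z₀.re| + D) := by
      rw [norm_mul, norm_mul, norm_real, Real.norm_of_nonneg hb.le]
      simpa using mul_le_mul_of_nonneg_left h1 (by positivity : (0 : ℝ) ≤ 2 * b)
    calc _ ≤ (Real.exp (b * (1 + D ^ 2)) * Real.exp (-(b / 2) * (t - z₀.re) ^ 2)) *
          (2 * b * (|t - z₀.re| + D)) * ‖ξ‖ := by gcongr
      _ = _ := by ring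
  · refine HasDerivAt.smul_const ?_ _
    have h1 : HasDerivAt (fun z : ℂ ↦ -(b : ℂ) * (t - z) ^ 2) (2 * b * (t - z)) z := by
      have := (((hasDerivAt_id z).const_sub (t : ℂ)).pow 2).const_mul (-(b : ℂ))
      convert! this using 1
      simp; ring
    exact h1.cexp

/-- At `z = 0` the kernel is real, so the integral can be formed inside the complete real space `K`.
-/
theorem _root_.gaussianSmoothing_mem [CompleteSpace H] {K : Submodule ℝ H}
    (hK : IsClosed (K : Set H)) {ξ : H} (hξ : ∀ t, u t ξ ∈ K) : gaussianSmoothing u b 0 ξ ∈ K := by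
  have : CompleteSpace K := hK.completeSpace_coe
  have h := K.subtypeₗᵢ.integral_comp_comm (μ := volume)
    fun t : ℝ ↦ Real.exp (-b * t ^ 2) • (⟨u t ξ, hξ t⟩ : K)
  have e : gaussianSmoothing u b 0 ξ = ∫ t : ℝ, K.subtypeₗᵢ
      (Real.exp (-b * t ^ 2) • (⟨u t ξ, hξ t⟩ : K)) := by
    refine integral_congr_ae (.of_forall fun t ↦ ?_)
    simp only [Submodule.subtypeₗᵢ, map_smul]
    change _ = Real.exp (-b * t ^ 2) • u t ξ
    rw [← Complex.coe_smul]
    simp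
  rw [e, h]
  exact Submodule.coe_mem _

/-- The rate `c² + 1` splits the kernel: `e^{-c²t²}`, normalized by `c/√π`, is an approximate
identity, while `e^{-t²}` makes the orbit map integrable without changing its value at `0`. -/
theorem tendsto_gaussianSmoothing [CompleteSpace H] (hu : IsModularPair u J) (ξ : H) :
    Tendsto (fun c : ℝ ↦ (c / √Real.pi) • gaussianSmoothing u (c ^ 2 + 1) 0 ξ) atTop (𝓝 ξ) := by
  have hspi : (0 : ℝ) < √Real.pi := Real.sqrt_pos.2 Real.pi_pos
  have h := tendsto_integral_comp_smul_smul_of_integrable (μ := (volume : Measure ℝ))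
    (φ := fun x ↦ Real.exp (-1 * x ^ 2) / √Real.pi) (fun x ↦ by positivity) ?_ ?_
    (hu.integrable_gaussian_orbit one_pos 0 ξ)
    (Continuous.continuousAt (Continuous.smul (by fun_prop) (hu.continuous ξ)))
  · simp only [ofReal_zero, hu.zero_apply] at h
    simp only [sub_zero, ne_eq, OfNat.ofNat_ne_zero, not_false_eq_true, zero_pow, mul_zero,
      Complex.exp_zero, one_smul] at h
    refine h.congr fun c ↦ ?_
    rw [gaussianSmoothing, ← integral_smul]
    refine integral_congr_ae (.of_forall fun t ↦ ?_)
    simp only [Module.finrank_self, pow_one, smul_eq_mul]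
    rw [← Complex.coe_smul, ← Complex.coe_smul, smul_smul, smul_smul]
    congr 1
    push_cast
    rw [mul_div_assoc', mul_div_right_comm, mul_assoc, ← Complex.exp_add]
    congr 2
    ring
  · rw [integral_div, integral_gaussian, div_one, div_self hspi.ne']
  · rw [Metric.cobounded_eq_cocompact]
    have h1 := (tendsto_rpow_abs_mul_exp_neg_mul_sq_cocompact one_pos 1).div_const √Real.pi
    simpa [mul_div_assoc] using h1

end IsModularPair

end Gaussian
-- Cyclicity and rigidity of `Fix(J Δ^{1/2})`
section StandardSubspaceAbstract

open Complex

variable {H : Type*} [NormedAddCommGroup H] [InnerProductSpace ℂ H]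
  {u : ℝ → H ≃ₗᵢ[ℝ] H} {J : H ≃ₗᵢ[ℝ] H} {b : ℝ} {K V : Submodule ℝ H}

namespace IsModularPair

theorem isStripExtension_gaussianSmoothing (hu : IsModularPair u J) (hb : 0 < b) (w : ℂ) (ξ : H) :
    IsStripExtension (fun t ↦ u t) (gaussianSmoothing u b w ξ)
      (fun z ↦ gaussianSmoothing u b (z + w) ξ) := by
  have h : Differentiable ℂ fun z ↦ gaussianSmoothing u b (z + w) ξ :=
    (hu.differentiable_gaussianSmoothing hb ξ).comp (by fun_prop : Differentiable ℂ fun z ↦ z + w)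
  exact ⟨h.continuous.continuousOn, h.differentiableOn,
    fun t ↦ by rw [hu.apply_gaussianSmoothing, add_comm]⟩

/-- The second term is `J Δ^{1/2}` applied to the first, as `J` conjugates the parameter `πi`; such
a sum is fixed by the involution `J Δ^{1/2}`. -/
theorem isModularFixed_gaussianSmoothing (hu : IsModularPair u J) (hb : 0 < b) (ξ : H) :
    IsModularFixed u J (gaussianSmoothing u b 0 ξ +
      gaussianSmoothing u b (-(Real.pi * I)) (J ξ)) := by
  have h1 := hu.isStripExtension_gaussianSmoothing hb 0 ξ
  have h2 := hu.isStripExtension_gaussianSmoothing hb (-(Real.pi * I)) (J ξ)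
  refine ⟨_, ⟨h1.1.add h2.1, h1.2.add h2.2, fun t ↦ ?_⟩, ?_⟩
  · rw [Pi.add_apply, h1.3, h2.3, _root_.map_add]
  · simp [hu.conj_gaussianSmoothing, hu.involutive, add_comm]

variable [CompleteSpace H]

theorem isCyclicSubspace (hu : IsModularPair u J) (hV : ∀ ξ, ξ ∈ V ↔ IsModularFixed u J ξ) :
    IsCyclicSubspace V := by
  intro ξ
  refine mem_closure_of_tendsto (hu.tendsto_gaussianSmoothing ξ) (.of_forall fun c ↦ ?_)
  have hb : 0 < c ^ 2 + 1 := by positivity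
  obtain ⟨L, hL⟩ := hu.exists_gaussianSmoothing_clm hb 0
  obtain ⟨M, hM⟩ := hu.exists_gaussianSmoothing_clm hb (-(Real.pi * I))
  have h1 := (hV _).2 (hu.isModularFixed_gaussianSmoothing hb ξ)
  -- By antilinearity of `J`, `I` times this vector is `L ξ - M (J ξ)`; adding `L ξ + M (J ξ)`
  -- leaves `2 L ξ`.
  have h2 := (hV _).2 (hu.isModularFixed_gaussianSmoothing hb (-I • ξ))
  refine ⟨_, V.smul_mem (c / √Real.pi / 2) h1, _, V.smul_mem (c / √Real.pi / 2) h2, ?_⟩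
  have hJ : J (-I • ξ) = I • J ξ := by rw [hu.antiunitary]; simp
  rw [hJ]
  simp only [← hL, ← hM, map_smul]
  simp only [← Complex.coe_smul, smul_add, smul_smul]
  push_cast
  match_scalars <;> ring_nf <;> simp
  ring

theorem isClosed_of_mem_iff (hu : IsModularPair u J) (hV : ∀ ξ, ξ ∈ V ↔ IsModularFixed u J ξ) :
    IsClosed (V : Set H) := by
  have e : (V : Set H) = {ξ | IsModularFixed u J ξ} := Set.ext hV
  exact e ▸ hu.isClosed_modularFixed

/-- Smoothing keeps `ξ` in `V`, which is closed and modular-invariant; uniqueness of the strip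
extension then identifies the value at `πi`. -/
theorem gaussianSmoothing_pi_mul_I (hu : IsModularPair u J)
    (hV : ∀ ξ, ξ ∈ V ↔ IsModularFixed u J ξ) (hb : 0 < b) {ξ : H} (hξ : ξ ∈ V) :
    gaussianSmoothing u b (Real.pi * I) ξ = J (gaussianSmoothing u b 0 ξ) := by
  have hmem : gaussianSmoothing u b 0 ξ ∈ V :=
    gaussianSmoothing_mem (hu.isClosed_of_mem_iff hV)
      fun t ↦ (hV _).2 (hu.isModularFixed_apply ((hV _).1 hξ) t)
  obtain ⟨F, hF, hpi⟩ := (hV _).1 hmem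
  have h := (hu.isStripExtension_gaussianSmoothing hb 0 ξ).eqOn hF (x := Real.pi * I)
    (by simp [Real.pi_pos.le])
  rw [← hpi, ← h]
  simp only [add_zero]

/-- A closed real subspace of `Fix(J Δ^{1/2})` which is cyclic and invariant under the modular
group is all of `Fix(J Δ^{1/2})`. -/
theorem eq_of_isCyclicSubspace (hu : IsModularPair u J)
    (hV : ∀ ξ, ξ ∈ V ↔ IsModularFixed u J ξ) (hKV : K ≤ V) (hK : IsClosed (K : Set H))
    (hcyc : IsCyclicSubspace K) (hinv : ∀ t, ∀ ξ ∈ K, u t ξ ∈ K) : K = V := by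
  refine le_antisymm hKV fun ξ hξ ↦ ?_
  refine hK.mem_of_tendsto (hu.tendsto_gaussianSmoothing ξ) (.of_forall fun c ↦ ?_)
  refine K.smul_mem _ ?_
  have hb : 0 < c ^ 2 + 1 := by positivity
  obtain ⟨L, hL⟩ := hu.exists_gaussianSmoothing_clm hb 0
  obtain ⟨M, hM⟩ := hu.exists_gaussianSmoothing_clm hb (Real.pi * I)
  have hLM : ∀ v ∈ V, J (M v) = L v := fun v hv ↦ by
    rw [hM, hu.gaussianSmoothing_pi_mul_I hV hb hv, hu.involutive, hL]
  -- This bounded real-linear map is `L` on `V` and vanishes on `I • V`, so it sends the dense set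
  -- `K + iK` into `K`, hence all of `H` into `K`.
  have hP : ∀ w : H, (2⁻¹ : ℂ) • (L w + J (M w)) ∈ (K : Set H) := by
    have hcl : IsClosed {w : H | (2⁻¹ : ℂ) • (L w + J (M w)) ∈ (K : Set H)} :=
      hK.preimage (by fun_prop)
    intro w
    refine hcl.closure_subset_iff.2 ?_ (hcyc w)
    rintro _ ⟨x, hx, y, hy, rfl⟩
    have e : (2⁻¹ : ℂ) • (L (x + I • y) + J (M (x + I • y))) = L x := by
      simp only [_root_.map_add, map_smul, hu.antiunitary I, hLM x (hKV hx), hLM y (hKV hy)]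
      simp only [smul_add, smul_smul, conj_I]
      match_scalars <;> ring
    rw [mem_ofPred_eq, e, hL]
    exact gaussianSmoothing_mem hK fun t ↦ hinv t x hx
  have h := hP ξ
  rw [hLM ξ hξ, ← two_smul ℂ, smul_smul, inv_mul_cancel₀ two_ne_zero, one_smul, hL] at h
  exact h

end IsModularPair

end StandardSubspaceAbstract
-- One-parameter subgroups and their uniqueness
section OneParameter

variable {E : Type*} [NormedAddCommGroup E] [NormedSpace ℝ E]
  {G : Type*} [TopologicalSpace G] [ChartedSpace E G] [Group G]

namespace IsOneParameterSubgroup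

variable {x y : GroupLieAlgebra 𝓘(ℝ, E) G} {γ γ' : ℝ → G}

theorem map_zero (hγ : IsOneParameterSubgroup x γ) : γ 0 = 1 := by
  have := hγ.map_add 0 0
  rw [add_zero] at this
  exact left_eq_mul.1 this

theorem continuous [IsTopologicalGroup G] (hγ : IsOneParameterSubgroup x γ) : Continuous γ := by
  refine continuous_iff_continuousAt.2 fun s ↦ ?_
  have h0 : ContinuousAt (fun t ↦ γ s * γ (t - s)) s := by
    refine continuousAt_const.mul (ContinuousAt.comp ?_ (by fun_prop))
    rw [sub_self]
    exact hγ.hasMFDerivAt_zero.continuousAt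
  refine h0.congr (.of_forall fun t ↦ ?_)
  simp only
  rw [← hγ.map_add, add_sub_cancel]

theorem comp_mulEquiv {τ : G ≃* G} (hγ : IsOneParameterSubgroup x γ)
    (hτ : MDifferentiableAt 𝓘(ℝ, E) 𝓘(ℝ, E) τ 1)
    (hx : (mfderiv 𝓘(ℝ, E) 𝓘(ℝ, E) τ 1 x : E) = (y : E)) :
    IsOneParameterSubgroup y (fun t ↦ τ (γ t)) := by
  refine ⟨fun s t ↦ by simp only [hγ.map_add, map_mul], ?_⟩
  have h1 : HasMFDerivAt 𝓘(ℝ, E) 𝓘(ℝ, E) τ (γ 0)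
      (mfderiv 𝓘(ℝ, E) 𝓘(ℝ, E) τ 1 : E →L[ℝ] E) := by
    rw [hγ.map_zero]; exact hτ.hasMFDerivAt
  have h2 := h1.comp 0 hγ.hasMFDerivAt_zero
  have e : ∀ (L : E →L[ℝ] E) (w : E),
      L.comp ((1 : ℝ →L[ℝ] ℝ).smulRight w) = (1 : ℝ →L[ℝ] ℝ).smulRight (L w) := by
    intro L w; ext; simp
  have h3 := (e (mfderiv 𝓘(ℝ, E) 𝓘(ℝ, E) τ 1) x).trans
    (congrArg (fun w : E ↦ (1 : ℝ →L[ℝ] ℝ).smulRight w) hx)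
  exact h3 ▸ h2

variable [LieGroup 𝓘(ℝ, E) ∞ G]

/-- The derivative at `0` determines the one at `s` through `γ t = γ s * γ (t - s)` and left
invariance of the field. -/
theorem isMIntegralCurve (hγ : IsOneParameterSubgroup x γ) :
    IsMIntegralCurve γ (mulInvariantVectorField (I := 𝓘(ℝ, E)) x) := by
  have h0 : HasMFDerivAt 𝓘(ℝ, ℝ) 𝓘(ℝ, E) γ 0
      ((1 : ℝ →L[ℝ] ℝ).smulRight (mulInvariantVectorField (I := 𝓘(ℝ, E)) x (γ 0))) := by
    have e : mulInvariantVectorField (I := 𝓘(ℝ, E)) x (γ 0) = (x : E) := by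
      rw [hγ.map_zero]
      have h1 : (fun y : G ↦ 1 * y) = id := by ext y; simp
      simp only [mulInvariantVectorField]
      rw [h1, mfderiv_id]
      rfl
    exact e.symm ▸ hγ.hasMFDerivAt_zero
  intro s
  have e : ∀ (L : E →L[ℝ] E) (w : E),
      L.comp ((1 : ℝ →L[ℝ] ℝ).smulRight w) = (1 : ℝ →L[ℝ] ℝ).smulRight (L w) := by
    intro L w; ext; simp
  have hsub : HasMFDerivAt 𝓘(ℝ, ℝ) 𝓘(ℝ, ℝ) (fun t : ℝ ↦ t - s) s (ContinuousLinearMap.id ℝ ℝ) :=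
    ((hasFDerivAt_id s).sub_const s).hasMFDerivAt
  have h0' : HasMFDerivAt 𝓘(ℝ, ℝ) 𝓘(ℝ, E) γ (s - s)
      ((1 : ℝ →L[ℝ] ℝ).smulRight (mulInvariantVectorField (I := 𝓘(ℝ, E)) x (γ (s - s)))) :=
    (sub_self s).symm ▸ h0
  have h1 : MDifferentiableAt 𝓘(ℝ, E) 𝓘(ℝ, E) (fun k : G ↦ γ s * k) (γ (s - s)) :=
    (contMDiff_mul_left (n := ∞)).contMDiffAt.mdifferentiableAt (by simp)
  have h2 := HasMFDerivAt.comp (f := fun t ↦ γ (t - s)) (g := fun k ↦ γ s * k) s h1.hasMFDerivAt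
    (HasMFDerivAt.comp (f := fun t ↦ t - s) (g := γ) s h0' hsub)
  have h3 : HasMFDerivAt 𝓘(ℝ, ℝ) 𝓘(ℝ, E) (fun t ↦ γ s * γ (t - s)) s ((1 : ℝ →L[ℝ] ℝ).smulRight
      (mulInvariantVectorField (I := 𝓘(ℝ, E)) x (γ s * γ (s - s)))) := by
    rw [← mulInvariantVectorField_mul_left]
    have h4 := e (mfderiv 𝓘(ℝ, E) 𝓘(ℝ, E) (fun k : G ↦ γ s * k) (γ (s - s)))
      (mulInvariantVectorField (I := 𝓘(ℝ, E)) x (γ (s - s)))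
    exact h4 ▸ h2
  have e1 : (fun t ↦ γ s * γ (t - s)) = γ := by
    ext t; rw [← hγ.map_add, add_sub_cancel]
  have e2 : γ s * γ (s - s) = γ s := congrFun e1 s
  rw [e1] at h3
  exact e2 ▸ h3

theorem eq [FiniteDimensional ℝ E] [T2Space G] (hγ : IsOneParameterSubgroup x γ)
    (hγ' : IsOneParameterSubgroup x γ') : γ = γ' := by
  have : CompleteSpace E := FiniteDimensional.complete ℝ E
  have : LieGroup 𝓘(ℝ, E) (minSmoothness ℝ 3) G := by
    rw [minSmoothness_of_isRCLikeNormedField]; infer_instance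
  have : IsManifold 𝓘(ℝ, E) 1 G := IsManifold.of_le (n := ∞) (by simp)
  have hv : ContMDiff 𝓘(ℝ, E) 𝓘(ℝ, E).tangent 1
      (fun g : G ↦ (⟨g, mulInvariantVectorField x g⟩ : TangentBundle 𝓘(ℝ, E) G)) :=
    (contMDiff_mulInvariantVectorField x).of_le
      (by rw [minSmoothness_of_isRCLikeNormedField]; norm_num)
  exact isMIntegralCurve_Ioo_eq_of_contMDiff_boundaryless (t₀ := 0) hv hγ.isMIntegralCurve
    hγ'.isMIntegralCurve (by rw [hγ.map_zero, hγ'.map_zero])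

end IsOneParameterSubgroup

/-- The differential of `τ` fixes `h` because `⁅h, h⁆ = 0`, so both curves are one-parameter
subgroups with the same velocity. This makes `J` commute with the modular group. -/
theorem IsEulerInvolution.map_expCurve [LieGroup 𝓘(ℝ, E) ∞ G]
    [FiniteDimensional ℝ E] [T2Space G] {h : GroupLieAlgebra 𝓘(ℝ, E) G} {τ : G ≃* G} (hτ : IsEulerInvolution h τ) (t : ℝ) :
    τ (expCurve h t) = expCurve h t := by
  have : CompleteSpace E := FiniteDimensional.complete ℝ E
  have : LieGroup 𝓘(ℝ, E) (minSmoothness ℝ 3) G := by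
    rw [minSmoothness_of_isRCLikeNormedField]; infer_instance
  have he := isOneParameterSubgroup_expCurve h
  have h1 : IsOneParameterSubgroup h (fun t ↦ τ (expCurve h t)) :=
    he.comp_mulEquiv (hτ.contMDiff.contMDiffAt.mdifferentiableAt (by simp))
      (hτ.deriv_zero h (lie_self h))
  exact congrFun (h1.eq he) t

end OneParameter
-- Cyclic subspaces and translates under the representation
section CyclicSubspace

variable {H : Type*} [NormedAddCommGroup H] [InnerProductSpace ℂ H] {V V' : Submodule ℝ H}

theorem IsCyclicSubspace.mono (hV : IsCyclicSubspace V) (hle : V ≤ V') : IsCyclicSubspace V' := by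
  refine Dense.mono ?_ hV
  rintro _ ⟨a, ha, b, hb, rfl⟩
  exact ⟨a, hle ha, b, hle hb, rfl⟩

end CyclicSubspace

namespace AntiunitaryRep

variable {G : Type*} [Group G] [TopologicalSpace G] {H : Type*} [NormedAddCommGroup H]
  [InnerProductSpace ℂ H] {τ : G ≃* G} {hτ : ∀ g, τ (τ g) = g} (U : AntiunitaryRep H τ hτ)
  {V V' : Submodule ℝ H}

theorem op_mul_apply (g k : G) (v : H) : U.op (g * k) v = U.op g (U.op k v) := by
  simp only [op, map_mul]
  rfl

theorem op_one_apply (v : H) : U.op 1 v = v := by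
  simp only [op, map_one]
  rfl

theorem J_J_apply (v : H) : U.J (U.J v) = v := by
  have h : U.toHom (SemidirectProduct.inr (-1)) * U.toHom (SemidirectProduct.inr (-1)) = 1 := by
    rw [← map_mul, ← map_mul]; simp
  exact DFunLike.congr_fun (congrArg Subtype.val h) v

theorem J_op_apply (g : G) (v : H) : U.J (U.op g v) = U.op (τ g) (U.J v) := by
  have h : U.toHom (SemidirectProduct.inr (-1)) * U.toHom (SemidirectProduct.inl g) =
      U.toHom (SemidirectProduct.inl (τ g)) * U.toHom (SemidirectProduct.inr (-1)) := by
    rw [← map_mul, ← map_mul]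
    have hJ : signAction τ hτ (-1) g = τ g := by simp [signAction]
    refine congrArg U.toHom (SemidirectProduct.ext ?_ (by simp))
    simp [hJ]
  exact DFunLike.congr_fun (congrArg Subtype.val h) v

theorem mem_translate {g : G} {v : H} : v ∈ U.translate g V ↔ U.op g⁻¹ v ∈ V := by
  constructor
  · rintro ⟨w, hw, rfl⟩
    change U.op g⁻¹ (U.op g w) ∈ V
    rwa [← op_mul_apply, inv_mul_cancel, op_one_apply]
  · intro h
    refine ⟨_, h, ?_⟩
    change U.op g (U.op g⁻¹ v) = v
    rw [← op_mul_apply, mul_inv_cancel, op_one_apply]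

theorem translate_one : U.translate 1 V = V := by
  ext v; rw [mem_translate, inv_one, op_one_apply]

theorem translate_translate (g k : G) : U.translate g (U.translate k V) = U.translate (g * k) V := by
  ext v; rw [mem_translate, mem_translate, mem_translate, ← op_mul_apply, mul_inv_rev]

theorem translate_mono (g : G) (hle : V ≤ V') : U.translate g V ≤ U.translate g V' :=
  Submodule.map_mono hle

theorem isClosed_translate (hV : IsClosed (V : Set H)) (g : G) :
    IsClosed (U.translate g V : Set H) := by
  have e : (U.translate g V : Set H) = U.op g⁻¹ ⁻¹' (V : Set H) := by
    ext v; exact U.mem_translate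
  rw [e]
  exact hV.preimage (U.op g⁻¹).continuous

theorem isCyclicSubspace_translate (hV : IsCyclicSubspace V) (g : G) :
    IsCyclicSubspace (U.translate g V) := by
  have h := DenseRange.dense_image (U.op g).surjective.denseRange (U.op g).continuous hV
  refine h.mono ?_
  rintro _ ⟨_, ⟨a, ha, b, hb, rfl⟩, rfl⟩
  refine ⟨U.op g a, Submodule.mem_map_of_mem ha, U.op g b, Submodule.mem_map_of_mem hb, ?_⟩
  rw [map_add]
  exact congrArg _ (U.unitary g Complex.I b)

end AntiunitaryRep

/-! ### The standard subspace `V(h, U)` as an instance of a modular pair -/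

section StandardSubspaceProperties

variable {E : Type*} [NormedAddCommGroup E] [NormedSpace ℝ E] [FiniteDimensional ℝ E]
  {G : Type*} [TopologicalSpace G] [ChartedSpace E G] [Group G] [LieGroup 𝓘(ℝ, E) ∞ G] [T2Space G]
  {H : Type*} [NormedAddCommGroup H] [InnerProductSpace ℂ H]
  {τ : G ≃* G} {hτ : ∀ g, τ (τ g) = g}

namespace AntiunitaryRep

theorem isModularPair [IsTopologicalGroup G] {h : GroupLieAlgebra 𝓘(ℝ, E) G}
    (hE : IsEulerInvolution h τ) (U : AntiunitaryRep H τ hτ) :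
    IsModularPair (fun t ↦ U.op (expCurve h t)) U.J where
  add_apply s t v := by
    rw [(isOneParameterSubgroup_expCurve h).map_add, U.op_mul_apply]
  unitary t := U.unitary _
  continuous v := (U.continuous v).comp (isOneParameterSubgroup_expCurve h).continuous
  antiunitary := U.antiunitary
  involutive := U.J_J_apply
  commute t v := by rw [U.J_op_apply, hE.map_expCurve]

theorem mem_standardSubspace_iff (U : AntiunitaryRep H τ hτ) (h : GroupLieAlgebra 𝓘(ℝ, E) G)
    (ξ : H) : ξ ∈ U.standardSubspace h ↔
      IsModularFixed (fun t ↦ U.op (expCurve h t)) U.J ξ :=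
  Iff.rfl

theorem translate_expCurve_standardSubspace [IsTopologicalGroup G]
    {h : GroupLieAlgebra 𝓘(ℝ, E) G} (hE : IsEulerInvolution h τ) (U : AntiunitaryRep H τ hτ)
    (t : ℝ) : U.translate (expCurve h t) (U.standardSubspace h) = U.standardSubspace h := by
  have hadd := (isOneParameterSubgroup_expCurve h).map_add
  have key : ∀ s, U.translate (expCurve h s) (U.standardSubspace h) ≤ U.standardSubspace h := by
    rintro s _ ⟨v, hv, rfl⟩
    exact (U.isModularPair hE).isModularFixed_apply hv s
  refine le_antisymm (key t) ?_
  have h1 := U.translate_mono (expCurve h t) (key (-t))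
  rwa [translate_translate, ← hadd, add_neg_cancel,
    (isOneParameterSubgroup_expCurve h).map_zero, translate_one] at h1

theorem mem_coreSubspace {U : AntiunitaryRep H τ hτ} {h : GroupLieAlgebra 𝓘(ℝ, E) G} {N : Set G}
    {v : H} : v ∈ U.coreSubspace h N ↔ ∀ g ∈ N, v ∈ U.translate g (U.standardSubspace h) := by
  simp only [coreSubspace, Submodule.mem_iInf]

end AntiunitaryRep

end StandardSubspaceProperties

/-! ### Translates of open sets and the maximal net -/

section NetProperties

variable {G : Type*} [Group G] [TopologicalSpace G] [IsTopologicalGroup G]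
  {H : Type*} [NormedAddCommGroup H] [InnerProductSpace ℂ H]
  {τ : G ≃* G} {hτ : ∀ g, τ (τ g) = g}

theorem mem_translateOpens {g k : G} {O : Opens G} : k ∈ translateOpens g O ↔ g⁻¹ * k ∈ O :=
  Set.mem_smul_set_iff_inv_smul_mem

theorem translateOpens_one (O : Opens G) : translateOpens 1 O = O :=
  Opens.ext (one_smul G (O : Set G))

theorem translateOpens_translateOpens (g k : G) (O : Opens G) :
    translateOpens g (translateOpens k O) = translateOpens (g * k) O :=
  Opens.ext (smul_smul g k (O : Set G))

theorem translateOpens_mono (g : G) {O O' : Opens G} (hle : O ≤ O') :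
    translateOpens g O ≤ translateOpens g O' :=
  Set.smul_set_mono hle

theorem mem_maximalNet {U : AntiunitaryRep H τ hτ} {V : Submodule ℝ H} {W O : Opens G} {v : H} :
    v ∈ maximalNet U V W O ↔ ∀ g, O ≤ translateOpens g W → v ∈ U.translate g V := by
  simp only [maximalNet, Submodule.mem_iInf]

theorem isClosed_maximalNet (U : AntiunitaryRep H τ hτ) {V : Submodule ℝ H}
    (hV : IsClosed (V : Set H)) (W O : Opens G) : IsClosed (maximalNet U V W O : Set H) := by
  simp only [maximalNet, Submodule.coe_iInf]
  exact isClosed_iInter fun g ↦ isClosed_iInter fun _ ↦ U.isClosed_translate hV g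

/-- Reindexing of the intersection: `gO ⊆ kW` if and only if `O ⊆ g⁻¹kW`. -/
theorem translate_maximalNet (U : AntiunitaryRep H τ hτ) (V : Submodule ℝ H) (W : Opens G) (g : G)
    (O : Opens G) :
    U.translate g (maximalNet U V W O) = maximalNet U V W (translateOpens g O) := by
  ext v
  rw [U.mem_translate, mem_maximalNet, mem_maximalNet]
  constructor
  · intro hv k hk
    have h1 := translateOpens_mono g⁻¹ hk
    rw [translateOpens_translateOpens, translateOpens_translateOpens, inv_mul_cancel,
      translateOpens_one] at h1
    have h2 := hv _ h1
    rwa [U.mem_translate, ← U.op_mul_apply, mul_inv_rev, inv_inv, mul_assoc, mul_inv_cancel,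
      mul_one, ← U.mem_translate] at h2
  · intro hv k hk
    have h1 := hv _ ((translateOpens_mono g hk).trans_eq (translateOpens_translateOpens g k W))
    rwa [U.mem_translate, mul_inv_rev, U.op_mul_apply, ← U.mem_translate] at h1

end NetProperties
-- Regularity and the existence of nets
section Main

variable {E : Type*} [NormedAddCommGroup E] [NormedSpace ℝ E] [FiniteDimensional ℝ E]
  {G : Type*} [TopologicalSpace G] [ChartedSpace E G] [Group G] [LieGroup 𝓘(ℝ, E) ∞ G]
  [IsTopologicalGroup G] [T2Space G] {h : GroupLieAlgebra 𝓘(ℝ, E) G}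
  {H : Type*} [NormedAddCommGroup H] [InnerProductSpace ℂ H]
  {τ : G ≃* G} {hτ : ∀ g, τ (τ g) = g} {U : AntiunitaryRep H τ hτ}

/-- The smallest `exp(ℝh)`-invariant open set containing `N`. -/
noncomputable def expSaturation (h : GroupLieAlgebra 𝓘(ℝ, E) G) (N : Opens G) : Opens G :=
  ⟨range (expCurve h) * (N : Set G), N.isOpen.mul_left⟩

theorem mem_expSaturation {N : Opens G} {g : G} :
    g ∈ expSaturation h N ↔ ∃ t, ∃ n ∈ N, expCurve h t * n = g := by
  constructor
  · rintro ⟨_, ⟨t, rfl⟩, n, hn, rfl⟩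
    exact ⟨t, n, hn, rfl⟩
  · rintro ⟨t, n, hn, rfl⟩
    exact ⟨_, ⟨t, rfl⟩, n, hn, rfl⟩

theorem translateOpens_expCurve_expSaturation (N : Opens G) (t : ℝ) :
    translateOpens (expCurve h t) (expSaturation h N) = expSaturation h N := by
  have hadd := (isOneParameterSubgroup_expCurve h).map_add
  have key : ∀ s, translateOpens (expCurve h s) (expSaturation h N) ≤ expSaturation h N := by
    rintro s _ ⟨k, hk, rfl⟩
    obtain ⟨r, n, hn, rfl⟩ := mem_expSaturation.1 hk
    exact mem_expSaturation.2 ⟨s + r, n, hn, by rw [hadd, mul_assoc]; rfl⟩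
  refine le_antisymm (key t) ?_
  have h1 := translateOpens_mono (expCurve h t) (key (-t))
  rwa [translateOpens_translateOpens, ← hadd, add_neg_cancel,
    (isOneParameterSubgroup_expCurve h).map_zero, translateOpens_one] at h1

theorem isConnected_expSaturation {N : Opens G} (hN : IsConnected (N : Set G)) :
    IsConnected (expSaturation h N : Set G) := by
  have h1 : IsConnected (range (expCurve h)) :=
    isConnected_range (isOneParameterSubgroup_expCurve h).continuous
  have h2 := (h1.prod hN).image (fun p : G × G ↦ p.1 * p.2) continuous_mul.continuousOn
  rwa [image_mul_prod] at h2

namespace IsCovariantNet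

variable {K : Opens G → Submodule ℝ H} {W : Opens G}

theorem isCyclicSubspace_coreSubspace (hK : IsCovariantNet U K)
    (hW : K W = U.standardSubspace h) {N : Set G} {O : Opens G} (hO : (O : Set G).Nonempty)
    (hN : N⁻¹ * (O : Set G) ⊆ (W : Set G)) : IsCyclicSubspace (U.coreSubspace h N) := by
  refine (hK.reehSchlieder O hO).mono fun v hv ↦ AntiunitaryRep.mem_coreSubspace.2 fun g hg ↦ ?_
  rw [← hW, hK.covariance]
  refine hK.isotony _ _ (fun k hk ↦ mem_translateOpens.2 ?_) hv
  exact hN (Set.mul_mem_mul (Set.inv_mem_inv.2 hg) hk)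

theorem isRegular [CompleteSpace H] (hE : IsEulerInvolution h τ) (hK : IsCovariantNet U K)
    (hW : K W = U.standardSubspace h) : U.IsRegular h := by
  rcases (W : Set G).eq_empty_or_nonempty with h0 | ⟨w, hw⟩
  -- For `W = ∅`, covariance gives `U(g)V = V` for all `g`, so `V_N = V` even with `N = G`.
  · have hW0 : ∀ g, translateOpens g W = W := fun g ↦ Opens.ext (by
      change g • (W : Set G) = W
      rw [h0, smul_set_empty])
    refine ⟨univ, univ_mem, IsCyclicSubspace.mono ((U.isModularPair hE).isCyclicSubspace
      (U.mem_standardSubspace_iff h)) fun v hv ↦ AntiunitaryRep.mem_coreSubspace.2 fun g _ ↦ ?_⟩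
    rwa [← hW, hK.covariance, hW0, hW]
  · have hcont : ContinuousAt (fun p : G × G ↦ p.1⁻¹ * p.2) (1, w) := by fun_prop
    have hmem := hcont.preimage_mem_nhds (t := (W : Set G)) (W.isOpen.mem_nhds (by simpa using hw))
    obtain ⟨N, hN, O, hO, hNO⟩ := mem_nhds_prod_iff.1 hmem
    obtain ⟨O', hO', hO'open, hwO'⟩ := mem_nhds_iff.1 hO
    refine ⟨N, hN, hK.isCyclicSubspace_coreSubspace hW (O := ⟨O', hO'open⟩) ⟨w, hwO'⟩ ?_⟩
    rintro _ ⟨g, hg, k, hk, rfl⟩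
    have := hNO (mk_mem_prod (Set.mem_inv.1 hg) (hO' hk))
    simpa using this

end IsCovariantNet

theorem translate_coreSubspace_le_maximalNet (hE : IsEulerInvolution h τ) {N : Set G}
    {N₁ : Opens G} (h1 : (1 : G) ∈ N₁) (hN : (N₁ : Set G) * (N₁ : Set G)⁻¹ ⊆ N) {O : Opens G}
    {k : G} (hk : k ∈ O) : U.translate k (U.coreSubspace h N) ≤
      maximalNet U (U.standardSubspace h) (expSaturation h N₁) O := by
  intro v hv
  rw [U.mem_translate, AntiunitaryRep.mem_coreSubspace] at hv
  refine mem_maximalNet.2 fun g hg ↦ ?_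
  obtain ⟨t, n, hn, hgk⟩ := mem_expSaturation.1 (mem_translateOpens.1 (hg hk))
  -- `n⁻¹ = 1 * n⁻¹` lies in `N₁N₁⁻¹ ⊆ N`.
  have h2 := hv n⁻¹ (hN ⟨1, h1, n⁻¹, Set.inv_mem_inv.2 hn, one_mul _⟩)
  rw [← U.mem_translate, U.translate_translate] at h2
  have e : k * n⁻¹ = g * expCurve h t := by
    rw [eq_mul_inv_of_mul_eq hgk]; group
  rwa [e, ← U.translate_translate, AntiunitaryRep.translate_expCurve_standardSubspace hE] at h2

variable [CompleteSpace H]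

theorem isCovariantNet_maximalNet (hE : IsEulerInvolution h τ) {N : Set G}
    (hcyc : IsCyclicSubspace (U.coreSubspace h N)) {N₁ : Opens G} (h1 : (1 : G) ∈ N₁)
    (hN : (N₁ : Set G) * (N₁ : Set G)⁻¹ ⊆ N) :
    IsCovariantNet U (maximalNet U (U.standardSubspace h) (expSaturation h N₁)) where
  isClosed O := isClosed_maximalNet U
    ((U.isModularPair hE).isClosed_of_mem_iff (U.mem_standardSubspace_iff h)) _ O
  isotony _ _ hle _ hv := mem_maximalNet.2 fun g hg ↦ mem_maximalNet.1 hv g (hle.trans hg)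
  covariance g O := translate_maximalNet U _ _ g O
  reehSchlieder _ := fun ⟨k, hk⟩ ↦
    (U.isCyclicSubspace_translate hcyc k).mono (translate_coreSubspace_le_maximalNet hE h1 hN hk)

/-- Taking `g = 1` in the intersection gives containment in `V`; invariance of `W` under `exp(ℝh)`
and covariance give modular invariance, so the rigidity of `V` applies. -/
theorem maximalNet_expSaturation (hE : IsEulerInvolution h τ) {N : Set G}
    (hcyc : IsCyclicSubspace (U.coreSubspace h N)) {N₁ : Opens G} (h1 : (1 : G) ∈ N₁)
    (hN : (N₁ : Set G) * (N₁ : Set G)⁻¹ ⊆ N) :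
    maximalNet U (U.standardSubspace h) (expSaturation h N₁) (expSaturation h N₁) =
      U.standardSubspace h := by
  have hnet := isCovariantNet_maximalNet hE hcyc h1 hN
  refine (U.isModularPair hE).eq_of_isCyclicSubspace (U.mem_standardSubspace_iff h) ?_
    (hnet.isClosed _) (hnet.reehSchlieder _ ⟨_, mem_expSaturation.2 ⟨0, 1, h1, rfl⟩⟩) ?_
  · intro v hv
    have := mem_maximalNet.1 hv 1 (translateOpens_one _).ge
    rwa [U.translate_one] at this
  · intro t v hv
    have h2 := hnet.covariance (expCurve h t) (expSaturation h N₁)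
    rw [translateOpens_expCurve_expSaturation] at h2
    exact h2.le ⟨v, hv, rfl⟩

theorem AntiunitaryRep.IsRegular.exists_net (hE : IsEulerInvolution h τ) (hU : U.IsRegular h) :
    ∃ (K : Opens G → Submodule ℝ H) (W : Opens G),
      IsCovariantNet U K ∧ BisognanoWichmann U h K W := by
  obtain ⟨N, hN, hcyc⟩ := hU
  have : LocallyConnectedSpace G := ChartedSpace.locallyConnectedSpace E G
  have hcont : ContinuousAt (fun p : G × G ↦ p.1 * p.2⁻¹) (1, 1) := by fun_prop
  have hmem := hcont.preimage_mem_nhds (t := N) (by simpa using hN)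
  rw [nhds_prod_eq, mem_prod_self_iff] at hmem
  obtain ⟨S, hS, hSN⟩ := hmem
  -- A connected choice of `N₁` is what makes `W` connected, as (BW) demands.
  obtain ⟨T, hTS, hT, h1T, hTc⟩ := locallyConnectedSpace_iff_subsets_isOpen_isConnected.1 this 1 S hS
  have hTN : T * T⁻¹ ⊆ N := by
    rintro _ ⟨a, ha, b, hb, rfl⟩
    simpa using hSN (mk_mem_prod (hTS ha) (hTS (Set.mem_inv.1 hb)))
  exact ⟨_, expSaturation h ⟨T, hT⟩, isCovariantNet_maximalNet (N₁ := ⟨T, hT⟩) hE hcyc h1T hTN,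
    isConnected_expSaturation (N := ⟨T, hT⟩) hTc, translateOpens_expCurve_expSaturation _,
    maximalNet_expSaturation (N₁ := ⟨T, hT⟩) hE hcyc h1T hTN⟩

end Main

theorem mainTheorem2
    {E : Type*} [NormedAddCommGroup E] [NormedSpace ℝ E] [FiniteDimensional ℝ E]
    {G : Type*} [TopologicalSpace G] [ChartedSpace E G] [Group G] [LieGroup 𝓘(ℝ, E) ∞ G]
    [IsTopologicalGroup G] [T2Space G]
    (h : GroupLieAlgebra 𝓘(ℝ, E) G) (hh : IsEulerElement h)
    (τ : G ≃* G) (hτ : IsEulerInvolution h τ)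
    {H : Type*} [NormedAddCommGroup H] [InnerProductSpace ℂ H] [CompleteSpace H]
    (U : AntiunitaryRep H τ hτ.involutive) :
    -- existence of a net with (Iso), (Cov), (RS), (BW) is equivalent to regularity
    ((∃ (K : Opens G → Submodule ℝ H) (W : Opens G),
        IsCovariantNet U K ∧ BisognanoWichmann U h K W) ↔ U.IsRegular h) ∧
    -- the same equivalence when `W` is only required to be an open subset
    ((∃ (K : Opens G → Submodule ℝ H) (W : Opens G),
        IsCovariantNet U K ∧ K W = U.standardSubspace h) ↔ U.IsRegular h) ∧
    -- which neighbourhoods `N` work, given a net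
    (∀ (K : Opens G → Submodule ℝ H) (W : Opens G),
      IsCovariantNet U K → K W = U.standardSubspace h →
      ∀ N ∈ 𝓝 (1 : G),
        (∃ O : Opens G, (O : Set G).Nonempty ∧ O ≤ W ∧
          N⁻¹ * (O : Set G) ⊆ (W : Set G)) →
        IsCyclicSubspace (U.coreSubspace h N)) ∧
    -- which net works, given a neighbourhood `N`
    (∀ N ∈ 𝓝 (1 : G), IsCyclicSubspace (U.coreSubspace h N) →
      ∀ N₁ : Opens G, (1 : G) ∈ N₁ → (N₁ : Set G) * (N₁ : Set G)⁻¹ ⊆ N →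
      ∃ W : Opens G,
        (W : Set G) = range (expCurve h) * (N₁ : Set G) ∧
        (∀ t : ℝ, translateOpens (expCurve h t) W = W) ∧
        (IsConnected (N₁ : Set G) → IsConnected (W : Set G)) ∧
        IsCovariantNet U (maximalNet U (U.standardSubspace h) W) ∧
        maximalNet U (U.standardSubspace h) W W = U.standardSubspace h) := by
  refine ⟨⟨?_, AntiunitaryRep.IsRegular.exists_net hτ⟩, ⟨?_, ?_⟩, ?_, ?_⟩
  · rintro ⟨K, W, hK, hW⟩
    exact hK.isRegular hτ hW.eq_standardSubspace
  · rintro ⟨K, W, hK, hW⟩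
    exact hK.isRegular hτ hW
  · intro hU
    obtain ⟨K, W, hK, hW⟩ := hU.exists_net hτ
    exact ⟨K, W, hK, hW.eq_standardSubspace⟩
  · rintro K W hK hW N - ⟨O, hO, -, hN⟩
    exact hK.isCyclicSubspace_coreSubspace hW hO hN
  · intro N _ hcyc N₁ h1 hN
    exact ⟨expSaturation h N₁, rfl, translateOpens_expCurve_expSaturation N₁,
      isConnected_expSaturation, isCovariantNet_maximalNet hτ hcyc h1 hN,
      maximalNet_expSaturation hτ hcyc h1 hN⟩
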